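/- Let $X$ be a locally compact separable metrizable space, $m$ a positive Radon measure on $X$ with full support, and $(\mathscr{E},\mathscr{F})$ a regular symmetric Dirichlet form on the real Hilbert space $L^2(X)=L^2(X,m)$; that is, $\mathscr{F}\subset L^2(X)$ is a dense subspace, $\mathscr{E}:\mathscr{F}\times\mathscr{F}\to\mathbb{R}$ is bilinear, symmetric and nonnegative, $\mathscr{F}$ is complete with respect to the norm $\|u\|_{\mathscr{E}}^2=\mathscr{E}(u,u)+\|u\|^2$, one has $u\wedge a\in\mathscr{F}$ and $\mathscr{E}(u\wedge a,u-u\wedge a)\ge 0$ for all $u\in\mathscr{F}$ and $a\ge 0$, and $\mathscr{F}\cap C_c(X)$ is dense in $\mathscr{F}$ with respect to $\|\cdot\|_{\mathscr{E}}$ and in $C_c(X)$ with respect to the uniform norm. Let $H\ge 0$ be the self-adjoint operator in $L^2(X)$ associated with $\mathscr{E}$ and $T_t=e^{-tH}$. For an open set $U\subset X$ let $\mathscr{E}_U$ be the restriction of $\mathscr{E}$ to the closure of $\mathscr{F}\cap C_c(U)$ in $(\mathscr{F},\|\cdot\|_{\mathscr{E}})$, and let $H_U$ be the self-adjoint operator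 in $L^2(U)$ associated with $\mathscr{E}_U$; bounded operators on $L^2(U)$ are viewed as operators on $L^2(X)$ which are $0$ on $L^2(X\setminus U)$. Let $B\subset X$ be closed and $U:=X\setminus B$. If the operator $\varphi(H_U)-\varphi(H)$ on $L^2(X)$ is compact for every $\varphi\in C_0(\mathbb{R})$, the space of continuous real-valued functions on $\mathbb{R}$ that vanish at infinity, then $\mathbf{1}_B T_t$ is a compact operator on $L^2(X)$ for every $t>0$. -/

import Mathlib

open MeasureTheory Filter Topology Set
open scoped ENNReal InnerProductSpace ZeroAtInfty

noncomputable section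

/-- The real Hilbert space `L²(Y, ν)`. -/
abbrev L2 {Y : Type*} [MeasurableSpace Y] (ν : Measure Y) : Type _ := Lp ℝ 2 ν

/-- The square `‖u‖_𝓔² = 𝓔(u,u) + ‖u‖²` of the form norm on the domain `D` of a form. -/
def formNormSq {Y : Type*} [MeasurableSpace Y] {ν : Measure Y} {D : Submodule ℝ (L2 ν)}
    (form : LinearMap.BilinForm ℝ D) (u : D) : ℝ :=
  form u u + ‖(u : L2 ν)‖ ^ 2

/-- A symmetric, nonnegative, closed bilinear form `𝓔 : 𝓕 × 𝓕 → ℝ` on `L²(Y, ν)`; closed means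
that `𝓕` is complete for the form norm.  (Density of `𝓕` is required in `DirichletForm` below.) -/
structure ClosedForm {Y : Type*} [MeasurableSpace Y] (ν : Measure Y) where
  /-- the domain `𝓕` -/
  dom : Submodule ℝ (L2 ν)
  /-- the bilinear form `𝓔` -/
  form : LinearMap.BilinForm ℝ dom
  symm : ∀ u v : dom, form u v = form v u
  nonneg : ∀ u : dom, 0 ≤ form u u
  complete : ∀ u : ℕ → dom,
    (∀ ε > 0, ∃ N, ∀ n ≥ N, ∀ k ≥ N, formNormSq form (u n - u k) < ε) →
      ∃ w : dom, Tendsto (fun n => formNormSq form (u n - w)) atTop (𝓝 0)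

namespace ClosedForm

variable {Y : Type*} [MeasurableSpace Y] {ν : Measure Y} (Q : ClosedForm ν)

/-- The domain `𝓕`, regarded as a Hilbert space with scalar product
`𝓔₁(u,v) = 𝓔(u,v) + ⟨u,v⟩`. -/
def Dom : Type _ := Q.dom

instance : AddCommGroup Q.Dom := inferInstanceAs (AddCommGroup Q.dom)

instance : Module ℝ Q.Dom := inferInstanceAs (Module ℝ Q.dom)

/-- The identity, from the domain without topology to the Hilbert space `(𝓕, 𝓔₁)`. -/
def toDom : Q.dom ≃ₗ[ℝ] Q.Dom := LinearEquiv.refl ℝ Q.dom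

instance innerCore : InnerProductSpace.Core ℝ Q.Dom where
  inner u v := Q.form (Q.toDom.symm u) (Q.toDom.symm v) +
    ⟪(Q.toDom.symm u : L2 ν), (Q.toDom.symm v : L2 ν)⟫_ℝ
  conj_inner_symm u v := by
    simp [Q.symm (Q.toDom.symm v) (Q.toDom.symm u), real_inner_comm]
  re_inner_nonneg u := by
    have := Q.nonneg (Q.toDom.symm u)
    have h2 : 0 ≤ ⟪(Q.toDom.symm u : L2 ν), (Q.toDom.symm u : L2 ν)⟫_ℝ := real_inner_self_nonneg
    simpa using add_nonneg this h2
  add_left u v w := by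
    simp only [map_add, LinearMap.add_apply, Submodule.coe_add, inner_add_left]; ring
  smul_left u v r := by
    simp only [map_smul, LinearMap.smul_apply, Submodule.coe_smul, real_inner_smul_left,
      smul_eq_mul, conj_trivial]; ring
  definite u hu := by
    have h1 := Q.nonneg (Q.toDom.symm u)
    have h2 : 0 ≤ ⟪(Q.toDom.symm u : L2 ν), (Q.toDom.symm u : L2 ν)⟫_ℝ := real_inner_self_nonneg
    have h3 : (Q.toDom.symm u : L2 ν) = 0 := by
      rw [← inner_self_eq_zero (𝕜 := ℝ)]; linarith
    have h4 : Q.toDom.symm u = 0 := by exact_mod_cast h3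
    simpa using h4

instance : NormedAddCommGroup Q.Dom := Q.innerCore.toNormedAddCommGroup

instance : InnerProductSpace ℝ Q.Dom := InnerProductSpace.ofCore Q.innerCore.toCore

theorem inner_dom (u v : Q.Dom) :
    ⟪u, v⟫_ℝ = Q.form (Q.toDom.symm u) (Q.toDom.symm v) +
      ⟪(Q.toDom.symm u : L2 ν), (Q.toDom.symm v : L2 ν)⟫_ℝ := rfl

theorem norm_sq_dom (u : Q.Dom) : ‖u‖ ^ 2 = formNormSq Q.form (Q.toDom.symm u) := by
  rw [← real_inner_self_eq_norm_sq, inner_dom, formNormSq, real_inner_self_eq_norm_sq]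

instance : CompleteSpace Q.Dom := by
  apply Metric.complete_of_cauchySeq_tendsto
  intro u hu
  obtain ⟨w, hw⟩ := Q.complete (fun n => Q.toDom.symm (u n)) (by
    intro ε hε
    obtain ⟨N, hN⟩ := Metric.cauchySeq_iff.1 hu (Real.sqrt ε) (Real.sqrt_pos.2 hε)
    refine ⟨N, fun n hn k hk => ?_⟩
    have h := hN n hn k hk
    rw [dist_eq_norm] at h
    rw [← map_sub, ← norm_sq_dom]
    exact (Real.lt_sqrt (norm_nonneg _)).1 h)
  refine ⟨Q.toDom w, ?_⟩
  rw [tendsto_iff_norm_sub_tendsto_zero]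
  have h : Tendsto (fun n => ‖u n - Q.toDom w‖ ^ 2) atTop (𝓝 0) := by
    refine hw.congr fun n => ?_
    rw [norm_sq_dom, map_sub, LinearEquiv.symm_apply_apply]
  have h' := h.sqrt
  simpa [Real.sqrt_sq] using h'

/-- The embedding of the Hilbert space `(𝓕, 𝓔₁)` into `L²`. -/
def embed : Q.Dom →L[ℝ] L2 ν :=
  LinearMap.mkContinuous (Q.dom.subtype ∘ₗ Q.toDom.symm.toLinearMap) 1 (by
    intro u
    rw [one_mul]
    refine abs_le_of_sq_le_sq' ?_ (norm_nonneg _) |>.2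
    rw [norm_sq_dom, formNormSq]
    have := Q.nonneg (Q.toDom.symm u)
    simpa using this)

theorem embed_apply (u : Q.Dom) : Q.embed u = (Q.toDom.symm u : L2 ν) := rfl

/-- Existence and uniqueness of `u = G₁ f ∈ 𝓕` with `𝓔(u,v) + ⟨u,v⟩ = ⟨f,v⟩` for all `v ∈ 𝓕`. -/
theorem exists_resolvent : ∃! G : L2 ν →L[ℝ] L2 ν, ∀ f : L2 ν, ∃ u : Q.dom, (u : L2 ν) = G f ∧
    ∀ v : Q.dom, Q.form u v + ⟪(u : L2 ν), (v : L2 ν)⟫_ℝ = ⟪f, (v : L2 ν)⟫_ℝ := by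
  refine ⟨Q.embed ∘L ContinuousLinearMap.adjoint Q.embed, ?_, ?_⟩
  · intro f
    refine ⟨Q.toDom.symm (ContinuousLinearMap.adjoint Q.embed f), rfl, fun v => ?_⟩
    have := ContinuousLinearMap.adjoint_inner_left Q.embed (Q.toDom v) f
    rw [inner_dom, embed_apply, LinearEquiv.symm_apply_apply] at this
    exact this
  · intro G hG
    ext1 f
    obtain ⟨u, hu, h⟩ := hG f
    rw [← hu]
    have : Q.toDom u = ContinuousLinearMap.adjoint Q.embed f := by
      refine ext_inner_right ℝ fun v => ?_
      rw [ContinuousLinearMap.adjoint_inner_left, inner_dom, embed_apply,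
        LinearEquiv.symm_apply_apply]
      exact h _
    rw [ContinuousLinearMap.comp_apply, ← this, embed_apply, LinearEquiv.symm_apply_apply]

/-- The resolvent `G₁ = (H + 1)⁻¹` of the operator `H` associated with the form: `u = G₁ f` is the
unique `u ∈ 𝓕` such that `𝓔(u,v) + ⟨u,v⟩ = ⟨f,v⟩` for all `v ∈ 𝓕`. -/
def resolvent : L2 ν →L[ℝ] L2 ν := Q.exists_resolvent.choose

theorem resolvent_spec (f : L2 ν) : ∃ u : Q.dom, (u : L2 ν) = Q.resolvent f ∧
    ∀ v : Q.dom, Q.form u v + ⟪(u : L2 ν), (v : L2 ν)⟫_ℝ = ⟪f, (v : L2 ν)⟫_ℝ :=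
  Q.exists_resolvent.choose_spec.1 f

/-- The graph of the operator `H` associated with the form by the representation theorem:
`u ∈ dom H` and `H u = h` iff `u ∈ 𝓕` and `𝓔(u,v) = ⟨h,v⟩` for all `v ∈ 𝓕`. -/
def operatorGraph : Set (L2 ν × L2 ν) :=
  {p | ∃ u : Q.dom, (u : L2 ν) = p.1 ∧ ∀ v : Q.dom, Q.form u v = ⟪p.2, (v : L2 ν)⟫_ℝ}

/-- `G₁` is the inverse of `H + 1`. -/
theorem mem_operatorGraph_iff (u h : L2 ν) :
    (u, h) ∈ Q.operatorGraph ↔ Q.resolvent (h + u) = u := by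
  constructor
  · rintro ⟨w, rfl, hw⟩
    obtain ⟨z, hz, hz'⟩ := Q.resolvent_spec (h + w)
    rw [← hz]
    congr 1
    apply Q.toDom.injective
    refine ext_inner_right ℝ fun v => ?_
    have e1 := hz' (Q.toDom.symm v)
    have e2 := hw (Q.toDom.symm v)
    rw [inner_add_left] at e1
    simp only [inner_dom, LinearEquiv.symm_apply_apply]
    dsimp only at e2
    rw [e1, e2]
  · intro e
    obtain ⟨z, hz, hz'⟩ := Q.resolvent_spec (h + u)
    refine ⟨z, hz.trans e, fun v => ?_⟩
    have e1 := hz' v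
    rw [hz, e, inner_add_left] at e1
    dsimp only
    linarith

end ClosedForm

/-- The complexification `f ↦ A (Re f) + i A (Im f)` on `L²(Y, ν; ℂ)` of a bounded operator `A` on
`L²(Y, ν; ℝ)`. -/
def complexify {Y : Type*} [MeasurableSpace Y] {ν : Measure Y} (A : L2 ν →L[ℝ] L2 ν) :
    Lp ℂ 2 ν →L[ℂ] Lp ℂ 2 ν where
  toFun f := Complex.ofRealCLM.compLpL 2 ν (A (Complex.reCLM.compLpL 2 ν f)) +
    Complex.I • Complex.ofRealCLM.compLpL 2 ν (A (Complex.imCLM.compLpL 2 ν f))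
  map_add' f g := by
    simp only [map_add, smul_add]; abel
  map_smul' c f := by
    have hre : Complex.reCLM.compLpL 2 ν (c • f) =
        c.re • Complex.reCLM.compLpL 2 ν f - c.im • Complex.imCLM.compLpL 2 ν f := by
      apply Lp.ext
      filter_upwards [Complex.reCLM.coeFn_compLpL (c • f), Complex.reCLM.coeFn_compLpL f,
        Complex.imCLM.coeFn_compLpL f, Lp.coeFn_smul c f,
        Lp.coeFn_sub (c.re • Complex.reCLM.compLpL 2 ν f) (c.im • Complex.imCLM.compLpL 2 ν f),
        Lp.coeFn_smul c.re (Complex.reCLM.compLpL 2 ν f),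
        Lp.coeFn_smul c.im (Complex.imCLM.compLpL 2 ν f)] with x h1 h2 h3 h4 h5 h6 h7
      rw [h5, Pi.sub_apply, h6, h7, h1, h4]
      simp [h2, h3, Complex.mul_re]
    have him : Complex.imCLM.compLpL 2 ν (c • f) =
        c.re • Complex.imCLM.compLpL 2 ν f + c.im • Complex.reCLM.compLpL 2 ν f := by
      apply Lp.ext
      filter_upwards [Complex.imCLM.coeFn_compLpL (c • f), Complex.reCLM.coeFn_compLpL f,
        Complex.imCLM.coeFn_compLpL f, Lp.coeFn_smul c f,
        Lp.coeFn_add (c.re • Complex.imCLM.compLpL 2 ν f) (c.im • Complex.reCLM.compLpL 2 ν f),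
        Lp.coeFn_smul c.re (Complex.imCLM.compLpL 2 ν f),
        Lp.coeFn_smul c.im (Complex.reCLM.compLpL 2 ν f)] with x h1 h2 h3 h4 h5 h6 h7
      rw [h5, Pi.add_apply, h6, h7, h1, h4]
      simp [h2, h3, Complex.mul_im]
    have hsm : ∀ (r : ℝ) (u : Lp ℂ 2 ν), r • u = (r : ℂ) • u := fun r u => by
      apply Lp.ext
      filter_upwards [Lp.coeFn_smul r u, Lp.coeFn_smul (r : ℂ) u] with x h1 h2
      rw [h1, h2]
      simp
    simp only [hre, him, map_add, map_sub, map_smul, RingHom.id_apply]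
    simp only [hsm]
    have hc : c = (c.re : ℂ) + (c.im : ℂ) * Complex.I := (Complex.re_add_im c).symm
    generalize Complex.ofRealCLM.compLpL 2 ν (A (Complex.reCLM.compLpL 2 ν f)) = a
    generalize Complex.ofRealCLM.compLpL 2 ν (A (Complex.imCLM.compLpL 2 ν f)) = b
    generalize c.re = x at *
    generalize c.im = y at *
    rw [hc]
    have hI : Complex.I * Complex.I = -1 := Complex.I_mul_I
    match_scalars <;>
      first
      | ring1
      | linear_combination (y : ℂ) * hI
      | linear_combination (-(y : ℂ)) * hI
  cont := by fun_prop

/-- The continuous functional calculus `A ↦ g(A)` for bounded self-adjoint operators `A` on a complex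
Hilbert space. -/
def realCfc {E : Type*} [NormedAddCommGroup E] [InnerProductSpace ℂ E] [CompleteSpace E]
    (g : ℝ → ℝ) (A : E →L[ℂ] E) : E →L[ℂ] E :=
  cfc g A

/-- For a real function `φ` on `ℝ`, the operator `φ(H)` on `L²(Y, ν)`, where `H ≥ 0` is the operator
associated with the form.  Since `H = G₁⁻¹ - 1` with `0 ≤ G₁ ≤ 1`, one has `φ(H) = g(G₁)` with
`g(s) = φ(s⁻¹ - 1)` for `s > 0` and `g(0) = φ(∞) = 0`; the function `g` is continuous on `[0,1]` when
`φ` is continuous on `[0,∞)` and vanishes at `+∞`.  The operator `g(G₁)` is given by the continuous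
functional calculus in the complex Hilbert space `L²(Y, ν; ℂ)`, restricted to the real-valued
functions (which it preserves, as `φ` is real). -/
def ClosedForm.functionOfOperator {Y : Type*} [MeasurableSpace Y] {ν : Measure Y}
    (Q : ClosedForm ν) (φ : ℝ → ℝ) : L2 ν →L[ℝ] L2 ν :=
  Complex.reCLM.compLpL 2 ν ∘L
    (realCfc (fun s : ℝ => if s = 0 then 0 else φ (s⁻¹ - 1)) (complexify Q.resolvent)).restrictScalars ℝ
      ∘L Complex.ofRealCLM.compLpL 2 ν

/-- The heat semigroup `T_t = e^{-tH}`, for `t > 0`. -/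
def ClosedForm.semigroup {Y : Type*} [MeasurableSpace Y] {ν : Measure Y}
    (Q : ClosedForm ν) (t : ℝ) : L2 ν →L[ℝ] L2 ν :=
  Q.functionOfOperator fun x => Real.exp (-t * x)

section Restriction

variable {X : Type*} [MeasurableSpace X] {m : Measure X}

/-- The restriction map `L²(X, m) → L²(U, m)`. -/
def restrictTo (m : Measure X) (U : Set X) : L2 m →L[ℝ] L2 (m.restrict U) :=
  LpToLpRestrictCLM X ℝ ℝ m 2 U

/-- The isometric embedding `L²(U, m) → L²(X, m)`, extending functions by `0` outside `U`. -/
def extendByZero {U : Set X} (hU : MeasurableSet U) : L2 (m.restrict U) →ₗᵢ[ℝ] L2 m where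
  toFun f := ((memLp_indicator_iff_restrict hU).2 (Lp.memLp f)).toLp (U.indicator f)
  map_add' f g := by
    rw [← MemLp.toLp_add, MemLp.toLp_eq_toLp_iff, ← indicator_add']
    exact (ae_eq_restrict_iff_indicator_ae_eq hU).1 (Lp.coeFn_add f g)
  map_smul' c f := by
    rw [RingHom.id_apply, ← MemLp.toLp_const_smul, MemLp.toLp_eq_toLp_iff]
    refine ((ae_eq_restrict_iff_indicator_ae_eq hU).1 (Lp.coeFn_smul c f)).trans ?_
    exact Eventually.of_forall fun x => congrFun (indicator_const_smul U c f) x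
  norm_map' f := by
    change ‖((memLp_indicator_iff_restrict hU).2 (Lp.memLp f)).toLp (U.indicator f)‖ = ‖f‖
    rw [Lp.norm_toLp, eLpNorm_indicator_eq_eLpNorm_restrict hU, Lp.norm_def]

theorem extendByZero_coeFn {U : Set X} (hU : MeasurableSet U) (f : L2 (m.restrict U)) :
    extendByZero hU f =ᵐ[m] U.indicator f := by
  have h : extendByZero hU f =
      ((memLp_indicator_iff_restrict hU).2 (Lp.memLp f)).toLp (U.indicator f) := rfl
  rw [h]
  exact MemLp.coeFn_toLp _

/-- An operator on `L²(U, m)`, viewed as an operator on `L²(X, m)` that is `0` on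
`L²(X ∖ U, m)`. -/
def extendOperator {U : Set X} (hU : MeasurableSet U)
    (A : L2 (m.restrict U) →L[ℝ] L2 (m.restrict U)) : L2 m →L[ℝ] L2 m :=
  (extendByZero hU).toContinuousLinearMap ∘L A ∘L restrictTo m U

/-- Multiplication `f ↦ 1_B f` by the indicator function of `B`. -/
def indicatorMul (m : Measure X) {B : Set X} (hB : MeasurableSet B) : L2 m →L[ℝ] L2 m :=
  (extendByZero hB).toContinuousLinearMap ∘L restrictTo m B

theorem indicatorMul_coeFn {B : Set X} (hB : MeasurableSet B) (f : L2 m) :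
    indicatorMul m hB f =ᵐ[m] B.indicator f := by
  exact (extendByZero_coeFn hB _).trans
    ((ae_eq_restrict_iff_indicator_ae_eq hB).1 (LpToLpRestrictCLM_coeFn ℝ B f))

end Restriction

section Dirichlet

variable {X : Type*} [TopologicalSpace X] [MeasurableSpace X] {m : Measure X}

/-- `u ∈ L²(X, m)` belongs to `C_c(U)`, for an open set `U`: it has a continuous representative with
compact support contained in `U`. -/
def IsCc (U : Set X) (u : L2 m) : Prop :=
  ∃ g : X → ℝ, Continuous g ∧ HasCompactSupport g ∧ tsupport g ⊆ U ∧ u =ᵐ[m] g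

/-- A symmetric Dirichlet form on `L²(X, m)`: a densely defined, closed, symmetric form with the
Markovian property `u ∧ a ∈ 𝓕` and `𝓔(u ∧ a, u - u ∧ a) ≥ 0` for all `u ∈ 𝓕`, `a ≥ 0`.  (The sector
condition holds with constant `1` by the Cauchy–Schwarz inequality.) -/
structure DirichletForm (m : Measure X) extends ClosedForm m where
  dense : Dense (dom : Set (L2 m))
  markov : ∀ u : dom, ∀ a : ℝ, 0 ≤ a → ∃ w : dom,
    ((w : L2 m) : X → ℝ) =ᵐ[m] (fun x => min ((u : L2 m) x) a) ∧ 0 ≤ form w (u - w)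

/-- Regularity: `𝓕 ∩ C_c(X)` is dense in `𝓕` for the form norm and in `C_c(X)` for the uniform
norm. -/
structure DirichletForm.IsRegular (E : DirichletForm m) : Prop where
  dense_dom : ∀ u : E.dom, ∀ ε > 0, ∃ v : E.dom,
    IsCc univ (v : L2 m) ∧ formNormSq E.form (u - v) < ε
  dense_Cc : ∀ g : X → ℝ, Continuous g → HasCompactSupport g → ∀ ε > 0,
    ∃ v : E.dom, ∃ h : X → ℝ, Continuous h ∧ HasCompactSupport h ∧ (v : L2 m) =ᵐ[m] h ∧
      ∀ x, |g x - h x| < ε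

/-- The subspace `𝓕 ∩ C_c(U)` of the Hilbert space `(𝓕, 𝓔₁)`. -/
def ClosedForm.core (Q : ClosedForm m) (U : Set X) : Submodule ℝ Q.Dom where
  carrier := {u | IsCc U (Q.embed u)}
  add_mem' := by
    rintro u v ⟨g, hg, hgc, hgU, hu⟩ ⟨h, hh, hhc, hhU, hv⟩
    refine ⟨g + h, hg.add hh, hgc.add hhc, (tsupport_add g h).trans (union_subset hgU hhU), ?_⟩
    rw [map_add]
    exact (Lp.coeFn_add _ _).trans (hu.add hv)
  zero_mem' := by
    refine ⟨0, continuous_zero, HasCompactSupport.zero, by simp, ?_⟩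
    rw [map_zero]
    exact Lp.coeFn_zero _ _ _
  smul_mem' := by
    rintro c u ⟨g, hg, hgc, hgU, hu⟩
    refine ⟨c • g, hg.const_smul c, hgc.smul_left (f := fun _ => c),
      (tsupport_smul_subset_right (fun _ => c) g).trans hgU, ?_⟩
    rw [map_smul]
    exact (Lp.coeFn_smul _ _).trans (hu.const_smul c)

/-- The closure of `𝓕 ∩ C_c(U)` in `𝓕` for the form norm. -/
def ClosedForm.restrictDom (Q : ClosedForm m) (U : Set X) : Submodule ℝ Q.Dom :=
  (Q.core U).topologicalClosure

/-- The elements of the closure of `𝓕 ∩ C_c(U)` vanish outside `U`: they are the extensions by `0` of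
functions in `L²(U, m)`. -/
theorem ClosedForm.exists_extendByZero (Q : ClosedForm m) {U : Set X} (hU : MeasurableSet U)
    (u : Q.Dom) (hu : u ∈ Q.restrictDom U) :
    ∃ f : L2 (m.restrict U), extendByZero hU f = Q.embed u := by
  have hcl : IsClosed (Q.embed ⁻¹' range (extendByZero (m := m) hU)) :=
    (extendByZero (m := m) hU).isometry.isClosedEmbedding.isClosed_range.preimage
      Q.embed.continuous
  refine closure_minimal ?_ hcl hu
  rintro v ⟨g, -, -, hgU, hv⟩
  refine ⟨restrictTo m U (Q.embed v), ?_⟩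
  apply Lp.ext
  refine (indicatorMul_coeFn hU (Q.embed v)).trans ?_
  filter_upwards [hv] with x hx
  by_cases hxU : x ∈ U
  · rw [indicator_of_mem hxU]
  · rw [indicator_of_notMem hxU, hx]
    by_contra h
    exact hxU (hgU (subset_tsupport g (Ne.symm h)))

/-- The domain of `𝓔_U` as a space of functions on `U`. -/
def ClosedForm.domOn (Q : ClosedForm m) {U : Set X} (hU : MeasurableSet U) :
    Submodule ℝ (L2 (m.restrict U)) :=
  ((Q.restrictDom U).map (Q.embed : Q.Dom →ₗ[ℝ] L2 m)).comap (extendByZero hU).toLinearMap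

theorem ClosedForm.mem_domOn (Q : ClosedForm m) {U : Set X} (hU : MeasurableSet U)
    (f : L2 (m.restrict U)) :
    f ∈ Q.domOn hU ↔ ∃ v ∈ Q.restrictDom U, Q.embed v = extendByZero hU f := Iff.rfl

/-- Extension by `0`, from the domain of `𝓔_U` to the domain of `𝓔`. -/
def ClosedForm.extendDom (Q : ClosedForm m) {U : Set X} (hU : MeasurableSet U) :
    Q.domOn hU →ₗ[ℝ] Q.dom :=
  ((extendByZero hU).toLinearMap ∘ₗ (Q.domOn hU).subtype).codRestrict Q.dom (by
    rintro ⟨f, hf⟩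
    obtain ⟨v, -, hv⟩ := (Q.mem_domOn hU f).1 hf
    change extendByZero hU f ∈ Q.dom
    rw [← hv, Q.embed_apply]
    exact (Q.toDom.symm v).2)

theorem ClosedForm.coe_extendDom (Q : ClosedForm m) {U : Set X} (hU : MeasurableSet U)
    (u : Q.domOn hU) : (Q.extendDom hU u : L2 m) = extendByZero hU (u : L2 (m.restrict U)) := rfl

/-- The restriction `𝓔_U` of the form to an open set `U`, a form on `L²(U, m)`: its domain is the
closure of `𝓕 ∩ C_c(U)` in `𝓕` for the form norm, as a space of functions on `U`. -/
def ClosedForm.restrictForm (Q : ClosedForm m) {U : Set X} (hU : MeasurableSet U) :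
    ClosedForm (m.restrict U) where
  dom := Q.domOn hU
  form := Q.form.compl₁₂ (Q.extendDom hU) (Q.extendDom hU)
  symm u v := Q.symm _ _
  nonneg u := Q.nonneg _
  complete u hu := by
    have hnorm : ∀ w : Q.domOn hU,
        formNormSq (Q.form.compl₁₂ (Q.extendDom hU) (Q.extendDom hU)) w =
          ‖Q.toDom (Q.extendDom hU w)‖ ^ 2 := fun w => by
      rw [Q.norm_sq_dom, LinearEquiv.symm_apply_apply, formNormSq, formNormSq, Q.coe_extendDom,
        LinearIsometry.norm_map]
      rfl
    have hmem : ∀ w : Q.domOn hU, Q.toDom (Q.extendDom hU w) ∈ Q.restrictDom U := by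
      intro w
      obtain ⟨v, hv, hv'⟩ := (Q.mem_domOn hU w).1 w.2
      have : Q.toDom (Q.extendDom hU w) = v := by
        rw [← LinearEquiv.eq_symm_apply]
        apply Subtype.ext
        rw [Q.coe_extendDom, ← Q.embed_apply, hv']
      rw [this]
      exact hv
    have hcau : CauchySeq fun n => Q.toDom (Q.extendDom hU (u n)) := by
      rw [Metric.cauchySeq_iff]
      intro ε hε
      obtain ⟨N, hN⟩ := hu (ε ^ 2) (by positivity)
      refine ⟨N, fun n hn k hk => ?_⟩
      have h := hN n hn k hk
      rw [hnorm, map_sub, map_sub] at h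
      rw [dist_eq_norm]
      exact lt_of_pow_lt_pow_left₀ 2 hε.le h
    obtain ⟨w, hw⟩ := cauchySeq_tendsto_of_complete hcau
    have hwU : w ∈ Q.restrictDom U :=
      (Q.core U).isClosed_topologicalClosure.mem_of_tendsto hw
        (Eventually.of_forall fun n => hmem (u n))
    obtain ⟨f, hf⟩ := Q.exists_extendByZero hU w hwU
    have hfU : f ∈ Q.domOn hU := (Q.mem_domOn hU f).2 ⟨w, hwU, hf.symm⟩
    refine ⟨⟨f, hfU⟩, ?_⟩
    have hwf : Q.toDom (Q.extendDom hU ⟨f, hfU⟩) = w := by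
      rw [← LinearEquiv.eq_symm_apply]
      apply Subtype.ext
      rw [Q.coe_extendDom, ← Q.embed_apply, hf]
    have h := (tendsto_iff_norm_sub_tendsto_zero.1 hw).pow 2
    rw [zero_pow two_ne_zero] at h
    refine h.congr fun n => ?_
    rw [hnorm, map_sub, map_sub, hwf]

end Dirichlet

end

/-! ### Complexification preserves positivity. -/

section Complexification

variable {Y : Type*} [MeasurableSpace Y] {ν : Measure Y}

/-! With `U = Bᶜ`, an operator extended from `L²(U)` takes values in functions vanishing on `B`, so
multiplication by `1_B` annihilates it (`indicatorMul_comp_extendOperator_compl`). Hence `1_B φ(H) =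
-1_B (φ(H_U) - φ(H))`, a bounded operator after a compact one, for every `φ ∈ C₀(ℝ)`. It remains to
write `T_t` as `φ(H)` with `φ ∈ C₀(ℝ)`. The function `e^{-tx}` blows up at `-∞`, but `e^{-t|x|}` is
in `C₀(ℝ)` and agrees with it on `[0, ∞)`; by `functionOfOperator_congr` only this half-line
matters. Since `φ(H)` is defined through the complexified resolvent, this amounts to locating the
spectrum of that operator in `[0, 1]`. The form gives `0 ≤ G₁ ≤ 1` on the real space, and
`complexify_isPositive` carries both inequalities to the complex space. -/

theorem complexify_apply (A : L2 ν →L[ℝ] L2 ν) (f : Lp ℂ 2 ν) :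
    complexify A f = Complex.ofRealCLM.compLpL 2 ν (A (Complex.reCLM.compLpL 2 ν f)) +
      Complex.I • Complex.ofRealCLM.compLpL 2 ν (A (Complex.imCLM.compLpL 2 ν f)) := rfl

theorem ofReal_re_add_I_smul_ofReal_im (f : Lp ℂ 2 ν) :
    Complex.ofRealCLM.compLpL 2 ν (Complex.reCLM.compLpL 2 ν f) +
      Complex.I • Complex.ofRealCLM.compLpL 2 ν (Complex.imCLM.compLpL 2 ν f) = f := by
  apply Lp.ext
  filter_upwards [Complex.reCLM.coeFn_compLpL f, Complex.imCLM.coeFn_compLpL f,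
    Complex.ofRealCLM.coeFn_compLpL (Complex.reCLM.compLpL 2 ν f),
    Complex.ofRealCLM.coeFn_compLpL (Complex.imCLM.compLpL 2 ν f),
    Lp.coeFn_add (Complex.ofRealCLM.compLpL 2 ν (Complex.reCLM.compLpL 2 ν f))
      (Complex.I • Complex.ofRealCLM.compLpL 2 ν (Complex.imCLM.compLpL 2 ν f)),
    Lp.coeFn_smul Complex.I (Complex.ofRealCLM.compLpL 2 ν (Complex.imCLM.compLpL 2 ν f))]
    with x h1 h2 h3 h4 h5 h6
  rw [h5, Pi.add_apply, h6, Pi.smul_apply, h3, h4, h1, h2]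
  simp [mul_comm Complex.I]

theorem inner_ofReal_compLpL (a b : L2 ν) :
    ⟪Complex.ofRealCLM.compLpL 2 ν a, Complex.ofRealCLM.compLpL 2 ν b⟫_ℂ = (⟪a, b⟫_ℝ : ℂ) := by
  rw [MeasureTheory.L2.inner_def, MeasureTheory.L2.inner_def, ← integral_complex_ofReal]
  refine integral_congr_ae ?_
  filter_upwards [Complex.ofRealCLM.coeFn_compLpL a, Complex.ofRealCLM.coeFn_compLpL b]
    with x h1 h2
  rw [h1, h2]
  simp

theorem complexify_one : complexify (1 : L2 ν →L[ℝ] L2 ν) = 1 := by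
  ext1 f
  rw [complexify_apply]
  exact ofReal_re_add_I_smul_ofReal_im f

theorem complexify_sub (A A' : L2 ν →L[ℝ] L2 ν) :
    complexify (A - A') = complexify A - complexify A' := by
  ext1 f
  simp only [complexify_apply, sub_apply, map_sub, smul_sub]
  abel

/-- The complexification of a positive operator is positive. -/
theorem complexify_isPositive {A : L2 ν →L[ℝ] L2 ν} (hA : A.IsPositive) :
    (complexify A).IsPositive := by
  -- Over `ℂ`, a real nonnegative quadratic form suffices; symmetry need not be checked separately.
  rw [ContinuousLinearMap.isPositive_iff_complex]
  intro f
  have key : ⟪complexify A f, f⟫_ℂ =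
      ((⟪A (Complex.reCLM.compLpL 2 ν f), Complex.reCLM.compLpL 2 ν f⟫_ℝ +
        ⟪A (Complex.imCLM.compLpL 2 ν f), Complex.imCLM.compLpL 2 ν f⟫_ℝ : ℝ) : ℂ) := by
    rw [complexify_apply]
    generalize hu : Complex.reCLM.compLpL 2 ν f = u
    generalize hv : Complex.imCLM.compLpL 2 ν f = v
    rw [← ofReal_re_add_I_smul_ofReal_im f, hu, hv]
    -- For `f = u + iv` the cross terms are `i (⟪A u, v⟫ - ⟪A v, u⟫)`, which vanish because `A` is
    -- symmetric.
    have hs : ⟪A v, u⟫_ℝ = ⟪A u, v⟫_ℝ := by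
      rw [real_inner_comm v (A u)]
      exact hA.isSymmetric v u
    simp only [inner_add_left, inner_add_right, inner_smul_left, inner_smul_right,
      inner_ofReal_compLpL, hs, Complex.conj_I, Complex.ofReal_add]
    linear_combination (-(⟪A v, v⟫_ℝ : ℂ)) * Complex.I_mul_I
  rw [key]
  refine ⟨by simp, ?_⟩
  simpa using add_nonneg (hA.inner_nonneg_left _) (hA.inner_nonneg_left _)

end Complexification

/-! ### Spectral bounds for the resolvent. -/

namespace ClosedForm

variable {Y : Type*} [MeasurableSpace Y] {ν : Measure Y} (Q : ClosedForm ν)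

/-- Testing the equation of `G₁ f` against `G₁ g` gives `⟪f, G₁ g⟫ = 𝓔₁(G₁ f, G₁ g)`, which is
symmetric and nonnegative for `f = g`. -/
theorem resolvent_isPositive : Q.resolvent.IsPositive := by
  rw [ContinuousLinearMap.isPositive_def]
  refine ⟨fun f g => ?_, fun f => ?_⟩
  · obtain ⟨u, hu, hu'⟩ := Q.resolvent_spec f
    obtain ⟨v, hv, hv'⟩ := Q.resolvent_spec g
    change ⟪Q.resolvent f, g⟫_ℝ = ⟪f, Q.resolvent g⟫_ℝ
    rw [← hu, ← hv, ← hu', real_inner_comm g, ← hv', Q.symm v u,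
      real_inner_comm (u : L2 ν) (v : L2 ν)]
  · obtain ⟨u, hu, hu'⟩ := Q.resolvent_spec f
    change 0 ≤ ⟪Q.resolvent f, f⟫_ℝ
    rw [← hu, real_inner_comm, ← hu']
    exact add_nonneg (Q.nonneg u) real_inner_self_nonneg

/-- With `u = G₁ f`, testing against `u` gives `⟪f - u, u⟫ = 𝓔(u,u)`, so `⟪f - u, f⟫ = ‖f - u‖² +
𝓔(u,u) ≥ 0`. -/
theorem one_sub_resolvent_isPositive : (1 - Q.resolvent).IsPositive := by
  refine ContinuousLinearMap.isPositive_def.2 ⟨?_, fun f => ?_⟩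
  · exact (ContinuousLinearMap.isPositive_one.isSymmetric).sub Q.resolvent_isPositive.isSymmetric
  · obtain ⟨u, hu, hu'⟩ := Q.resolvent_spec f
    change 0 ≤ ⟪f - Q.resolvent f, f⟫_ℝ
    have h1 := hu' u
    have h2 := Q.nonneg u
    have h3 : 0 ≤ ⟪f - (u : L2 ν), f - (u : L2 ν)⟫_ℝ := real_inner_self_nonneg
    rw [← hu]
    simp only [inner_sub_left, inner_sub_right] at h3 ⊢
    rw [real_inner_comm f (u : L2 ν)] at h3 ⊢
    linarith

theorem spectrum_complexify_resolvent_subset :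
    spectrum ℝ (complexify Q.resolvent) ⊆ Icc 0 1 := by
  intro s hs
  have h0 : 0 ≤ complexify Q.resolvent :=
    (ContinuousLinearMap.nonneg_iff_isPositive _).2 (complexify_isPositive Q.resolvent_isPositive)
  have h1 : 0 ≤ 1 - complexify Q.resolvent := by
    rw [← complexify_one, ← complexify_sub]
    exact (ContinuousLinearMap.nonneg_iff_isPositive _).2
      (complexify_isPositive Q.one_sub_resolvent_isPositive)
  refine ⟨spectrum_nonneg_of_nonneg h0 hs, ?_⟩
  -- The upper bound is the lower bound for `1 - G₁`, whose spectrum is the reflection `s ↦ 1 - s`.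
  have h2 : 1 - s ∈ spectrum ℝ (1 - complexify Q.resolvent) := by
    rw [← map_one (algebraMap ℝ (Lp ℂ 2 ν →L[ℂ] Lp ℂ 2 ν)), ← spectrum.singleton_sub_eq]
    exact Set.sub_mem_sub rfl hs
  linarith [spectrum_nonneg_of_nonneg h1 h2]

/-- `φ(H)` depends only on the restriction of `φ` to `[0, ∞)`. -/
theorem functionOfOperator_congr {φ ψ : ℝ → ℝ} (h : EqOn φ ψ (Ici 0)) :
    Q.functionOfOperator φ = Q.functionOfOperator ψ := by
  have hcfc : realCfc (fun s : ℝ => if s = 0 then 0 else φ (s⁻¹ - 1)) (complexify Q.resolvent) =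
      realCfc (fun s : ℝ => if s = 0 then 0 else ψ (s⁻¹ - 1)) (complexify Q.resolvent) := by
    -- Agreement on the spectrum is enough: at `s = 0` both functions have the prescribed value `0`,
    -- and for `0 < s ≤ 1` the argument `s⁻¹ - 1` lies in `[0, ∞)`.
    refine cfc_congr fun s hs => ?_
    obtain ⟨h0, h1⟩ := Q.spectrum_complexify_resolvent_subset hs
    by_cases hs0 : s = 0
    · simp [hs0]
    · have : 1 ≤ s⁻¹ := (one_le_inv₀ (lt_of_le_of_ne h0 (Ne.symm hs0))).2 h1
      simp only [hs0, if_false]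
      exact h (sub_nonneg.2 this)
  rw [functionOfOperator, functionOfOperator, hcfc]

end ClosedForm

/-! ### Compactness of `1_B T_t`. -/

/-- The function `x ↦ e^{-t|x|}` in `C₀(ℝ)`, for `t > 0`. -/
noncomputable def expNegMulAbs {t : ℝ} (ht : 0 < t) : C₀(ℝ, ℝ) where
  toFun x := Real.exp (-t * |x|)
  continuous_toFun := by fun_prop
  zero_at_infty' := by
    refine Real.tendsto_exp_atBot.comp ?_
    exact (tendsto_norm_cocompact_atTop (E := ℝ)).const_mul_atTop_of_neg (neg_lt_zero.2 ht)

/-- Extension by zero from `Bᶜ` leaves nothing on `B`, whatever the operator `A` is. -/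
theorem indicatorMul_comp_extendOperator_compl {X : Type*} [MeasurableSpace X] {m : Measure X}
    {B : Set X} (hB : MeasurableSet B) (hU : MeasurableSet Bᶜ)
    (A : L2 (m.restrict Bᶜ) →L[ℝ] L2 (m.restrict Bᶜ)) :
    indicatorMul m hB ∘L extendOperator hU A = 0 := by
  ext1 f
  apply Lp.ext
  filter_upwards [indicatorMul_coeFn hB (extendOperator hU A f),
    extendByZero_coeFn hU (A (restrictTo m Bᶜ f)), Lp.coeFn_zero ℝ 2 m] with x h1 h2 h3
  change indicatorMul m hB (extendOperator hU A f) x = (0 : L2 m) x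
  rw [h1, h3]
  by_cases hx : x ∈ B
  · rw [indicator_of_mem hx]
    exact h2.trans (indicator_of_notMem (not_not.2 hx) _)
  · rw [indicator_of_notMem hx]
    rfl

theorem proposition5p6 {X : Type*} [TopologicalSpace X] [LocallyCompactSpace X]
    [TopologicalSpace.SeparableSpace X] [TopologicalSpace.MetrizableSpace X]
    [MeasurableSpace X] [BorelSpace X]
    (m : Measure X) [m.Regular] [m.IsOpenPosMeasure]
    (E : DirichletForm m) (hE : E.IsRegular)
    (B : Set X) (hB : IsClosed B)
    (hcomp : ∀ φ : C₀(ℝ, ℝ), IsCompactOperator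
      (extendOperator hB.isOpen_compl.measurableSet
          ((E.restrictForm hB.isOpen_compl.measurableSet).functionOfOperator φ) -
        E.functionOfOperator φ)) :
    ∀ t : ℝ, 0 < t → IsCompactOperator (indicatorMul m hB.measurableSet ∘L E.semigroup t) := by
  intro t ht
  have hU : MeasurableSet Bᶜ := hB.isOpen_compl.measurableSet
  have hφ : E.semigroup t = E.functionOfOperator (expNegMulAbs ht) :=
    E.functionOfOperator_congr fun x hx => by
      change Real.exp (-t * x) = Real.exp (-t * |x|)
      rw [abs_of_nonneg hx]
  -- Compact operators are stable under composition with a bounded operator on the left.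
  have h := (hcomp (expNegMulAbs ht)).clm_comp (indicatorMul m hB.measurableSet)
  have heq : indicatorMul m hB.measurableSet ∘L E.semigroup t =
      -(indicatorMul m hB.measurableSet ∘L
        (extendOperator hU ((E.restrictForm hU).functionOfOperator (expNegMulAbs ht)) -
          E.functionOfOperator (expNegMulAbs ht))) := by
    rw [ContinuousLinearMap.comp_sub, indicatorMul_comp_extendOperator_compl, zero_sub, neg_neg,
      hφ]
  rw [heq]
  exact h.neg
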